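/- Let $\mathbb{T}^{2n}=(\mathbb{R}/\mathbb{Z})^{2n}$ with coordinates $(p_1,q_1,\dots,p_n,q_n)$ and $\omega_{\mathrm{std}}=\sum_{i=1}^n dp_i\wedge dq_i$, and let $S^1=\mathbb{R}/\mathbb{Z}$. For a free homotopy class $\alpha\in[S^1,\mathbb{T}^{2n}]$ let $\mathcal{L}_\alpha\mathbb{T}^{2n}$ be the set of smooth loops $S^1\to\mathbb{T}^{2n}$ representing $\alpha$, with the $C^\infty$ topology, and let $\alpha^k$ be the $k$-fold iterate of $\alpha$, i.e. the class of $t\mapsto x(kt)$ for $x$ representing $\alpha$. For $A\in\pi_1(\mathcal{L}_\alpha\mathbb{T}^{2n},z)$ let $\langle\overline{[\omega_{\mathrm{std}}]},A\rangle=\int_{S^1\times S^1}u^*\omega_{\mathrm{std}}\in\mathbb{R}$, where $u\colon S^1\times S^1\to\mathbb{T}^{2n}$ is a smooth map such that the loop $s\mapsto u(s,\cdot)$ in $\mathcal{L}_\alpha\mathbb{T}^{2n}$ is based at $z$ and represents $A$, and let $\langle\overline{[\omega_{\mathrm{std}}]},\pi_1(\mathcal{L}_\alpha\mathbb{T}^{2n})\rangle\subset\mathbb{R}$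 be the set of these values. Call $e\in\mathbb{Z}^{2n}$ primitive if $e\ne kf$ for all positive integers $k$ and all $f\in\mathbb{Z}^{2n}\setminus\{e\}$. Sending $a\in\mathbb{Z}^{2n}$ to the class of $t\mapsto ta$ is a bijection $\mathbb{Z}^{2n}\cong[S^1,\mathbb{T}^{2n}]$. Every $\mathcal{L}_\alpha\mathbb{T}^{2n}$ is non-empty, and every $\alpha$ can be written as $\alpha=h_\alpha e_\alpha$, where $h_\alpha$ is a positive integer and $e_\alpha\in\mathbb{Z}^{2n}$ is primitive if $\alpha$ is non-trivial, and $h_\alpha=0$, $e_\alpha=0$ if $\alpha$ is trivial. The pairing above is well defined: every $A$ has a representative $u$, and the integral does not depend on the choice of $u$. For every $\alpha$, every base point $z\in\mathcal{L}_\alpha\mathbb{T}^{2n}$ and all $h_\alpha$, $e_\alpha=(e_1,\dots,e_{2n})$ as above, $$\langle\overline{[\omega_{\mathrm{std}}]},\pi_1(\mathcal{L}_\alpha\mathbb{T}^{2n})\rangle =h_\alpha\Bigl\{\sum_{i=1}^n\begin{vmatrix}e_{2i-1}&b_{2i-1}\\ e_{2i}&b_{2i}\end{vmatrix} \Bigm|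 (b_1,\dots,b_{2n})\in\mathbb{Z}^{2n}\Bigr\}=h_\alpha\mathbb{Z}.$$ Consequently $$\langle\overline{[\omega_{\mathrm{std}}]},\pi_1(\mathcal{L}_{\alpha^k}\mathbb{T}^{2n})\rangle=k\,\langle\overline{[\omega_{\mathrm{std}}]},\pi_1(\mathcal{L}_{\alpha}\mathbb{T}^{2n})\rangle$$ for all $\alpha\in[S^1,\mathbb{T}^{2n}]$, all integers $k\ge 0$ and all base points. In particular $\omega_{\mathrm{std}}$ is $\alpha$-toroidally rational for every $\alpha$, i.e. $\langle\overline{[\omega_{\mathrm{std}}]},\pi_1(\mathcal{L}_\alpha\mathbb{T}^{2n})\rangle$ is a discrete subset of $\mathbb{R}$. -/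

import Mathlib

open scoped ContDiff Pointwise

/-- The circle `S¹ = ℝ/ℤ` is Mathlib's `UnitAddCircle`, and the torus `(ℝ/ℤ)^m` is Mathlib's
`UnitAddTorus (Fin m)`, that is `Fin m → UnitAddCircle`. -/
abbrev Torus (m : ℕ) : Type := UnitAddTorus (Fin m)

/-- The standard embedding `ℝ/ℤ → ℂ`, `x ↦ exp (2πix)`. It is a diffeomorphism onto the unit
circle, so it determines the smooth structure of `ℝ/ℤ`. -/
noncomputable def circleEmb (x : UnitAddCircle) : ℂ := (AddCircle.toCircle x : ℂ)

theorem continuous_circleEmb : Continuous circleEmb :=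
  continuous_subtype_val.comp AddCircle.continuous_toCircle

theorem circleEmb_coe (x : ℝ) :
    circleEmb (x : UnitAddCircle) = Complex.exp ((2 * Real.pi * x : ℝ) * Complex.I) := by
  simp [circleEmb, AddCircle.toCircle_apply_mk, Circle.coe_exp]

/-- A map from a normed space to the torus is smooth if all its coordinates are smooth as maps to
the unit circle in `ℂ`. -/
def IsSmooth {E : Type*} [NormedAddCommGroup E] [NormedSpace ℝ E] {m : ℕ}
    (f : E → Torus m) : Prop :=
  ∀ j, ContDiff ℝ ∞ (fun x => circleEmb (f x j))

/-- The derivative of a curve in `ℝ/ℤ`, as an element of the tangent space `ℝ` of `ℝ/ℤ`: if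
`z = exp (2πiθ)` then `θ' = Im (z' * conj z) / 2π`, see `circleDeriv_coe`. -/
noncomputable def circleDeriv (c : ℝ → UnitAddCircle) (t : ℝ) : ℝ :=
  (deriv (fun τ => circleEmb (c τ)) t * (starRingEnd ℂ) (circleEmb (c t))).im / (2 * Real.pi)

/-- The derivative of `t ↦ θ t mod 1` is `θ'`. -/
theorem circleDeriv_coe (θ : ℝ → ℝ) (t : ℝ) (hθ : DifferentiableAt ℝ θ t) :
    circleDeriv (fun τ => (θ τ : UnitAddCircle)) t = deriv θ t := by
  have h1 : HasDerivAt (fun τ => circleEmb (θ τ : UnitAddCircle))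
      (Complex.exp ((2 * Real.pi * θ t : ℝ) * Complex.I) *
        ((2 * Real.pi * deriv θ t : ℝ) * Complex.I)) t := by
    simp only [circleEmb_coe]
    exact (((hθ.hasDerivAt.const_mul (2 * Real.pi)).ofReal_comp).mul_const Complex.I).cexp
  have h2 : Complex.exp ((2 * Real.pi * θ t : ℝ) * Complex.I) *
      (starRingEnd ℂ) (Complex.exp ((2 * Real.pi * θ t : ℝ) * Complex.I)) = 1 := by
    rw [Complex.mul_conj, Complex.normSq_eq_norm_sq, Complex.norm_exp_ofReal_mul_I]
    simp
  unfold circleDeriv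
  rw [h1.deriv, circleEmb_coe, mul_right_comm, h2, one_mul]
  have h3 : 2 * Real.pi ≠ 0 := by positivity
  rw [Complex.im_ofReal_mul, Complex.I_im, mul_one, mul_div_cancel_left₀ _ h3]

/-- The velocity of a curve in the torus, in the tangent space `ℝ^m`. -/
noncomputable def torusDeriv {m : ℕ} (c : ℝ → Torus m) (t : ℝ) : Fin m → ℝ :=
  fun j => circleDeriv (fun τ => c τ j) t

/-! ### The standard symplectic form -/

/-- The `0`-based index of the coordinate `p_i` (the `(2i-1)`-st coordinate). -/
def pIdx {n : ℕ} (i : Fin n) : Fin (2 * n) := ⟨2 * i, by omega⟩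

/-- The `0`-based index of the coordinate `q_i` (the `2i`-th coordinate). -/
def qIdx {n : ℕ} (i : Fin n) : Fin (2 * n) := ⟨2 * i + 1, by omega⟩

/-- The standard symplectic form `∑ dp_i ∧ dq_i`; all tangent spaces of `(ℝ/ℤ)^(2n)` are identified
with `ℝ^(2n)` by translation, and the form is translation invariant. -/
def omegaStd {n : ℕ} (v w : Fin (2 * n) → ℝ) : ℝ :=
  ∑ i : Fin n, (v (pIdx i) * w (qIdx i) - v (qIdx i) * w (pIdx i))

/-! ### Free homotopy classes -/

/-- Free homotopy of loops `S¹ → (ℝ/ℤ)^m`. -/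
instance freeHomotopySetoid (m : ℕ) : Setoid C(UnitAddCircle, Torus m) where
  r := ContinuousMap.Homotopic
  iseqv := ContinuousMap.Homotopic.equivalence

/-- The set `[S¹, (ℝ/ℤ)^m]` of free homotopy classes of loops. -/
def FreeHomotopyClass (m : ℕ) : Type := Quotient (freeHomotopySetoid m)

/-- The free homotopy class of a loop. -/
def freeClass {m : ℕ} (γ : C(UnitAddCircle, Torus m)) : FreeHomotopyClass m :=
  Quotient.mk (freeHomotopySetoid m) γ

/-- The class of constant loops. -/
def trivialClass (m : ℕ) : FreeHomotopyClass m := freeClass (ContinuousMap.const _ 0)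

/-- The class of the linear loop `t ↦ t a` for `a ∈ ℤ^m`. -/
def linearClass {m : ℕ} (a : Fin m → ℤ) : FreeHomotopyClass m :=
  freeClass ⟨fun t j => a j • t, by fun_prop⟩

/-- The `k`-fold iterate `α^k`, the class of `t ↦ γ (k t)` where `γ` represents `α`. -/
def iterateClass {m : ℕ} (α : FreeHomotopyClass m) (k : ℕ) : FreeHomotopyClass m :=
  Quotient.map (sa := freeHomotopySetoid m) (sb := freeHomotopySetoid m)
    (fun γ => γ.comp ⟨fun t => k • t, by fun_prop⟩)
    (fun _ _ h => ContinuousMap.Homotopic.comp h (ContinuousMap.Homotopic.refl _)) α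

/-- `e` is primitive if `e ≠ k f` for all positive integers `k` and all `f ≠ e`. -/
def IsPrimitive {m : ℕ} (e : Fin m → ℤ) : Prop :=
  ∀ k : ℕ, 0 < k → ∀ f : Fin m → ℤ, f ≠ e → e ≠ k • f

/-- `α = h e` under `ℤ^m ≅ [S¹, (ℝ/ℤ)^m]`, where `h` is a positive integer and `e` is primitive if
`α` is non-trivial, and `h = 0`, `e = 0` if `α` is trivial. -/
def IsPrimitiveDecomposition {m : ℕ} (α : FreeHomotopyClass m) (h : ℕ) (e : Fin m → ℤ) : Prop :=
  α = linearClass (h • e) ∧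
    ((α ≠ trivialClass m ∧ 0 < h ∧ IsPrimitive e) ∨ (α = trivialClass m ∧ h = 0 ∧ e = 0))

/-! ### The free loop space -/

/-- Smooth loops `S¹ → (ℝ/ℤ)^m`. -/
structure SmoothLoop (m : ℕ) where
  toMap : C(UnitAddCircle, Torus m)
  smooth : IsSmooth (fun t : ℝ => toMap (t : UnitAddCircle))

/-- The `k`-th derivative of the `j`-th coordinate of a smooth loop, the coordinate being regarded
as a (`1`-periodic) map to the unit circle in `ℂ`. -/
noncomputable def SmoothLoop.jet {m : ℕ} (k : ℕ) (j : Fin m) (γ : SmoothLoop m) : C(ℝ, ℂ) where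
  toFun := iteratedDeriv k (fun t : ℝ => circleEmb (γ.toMap (t : UnitAddCircle) j))
  continuous_toFun := (γ.smooth j).continuous_iteratedDeriv k (by exact_mod_cast le_top)

/-- The `C^∞` topology on the loop space: uniform convergence of all derivatives. (Locally uniform
convergence on `ℝ` is uniform convergence, by periodicity.) -/
noncomputable instance (m : ℕ) : TopologicalSpace (SmoothLoop m) :=
  ⨅ (k : ℕ) (j : Fin m), TopologicalSpace.induced (SmoothLoop.jet k j) inferInstance

/-- The component of the loop space that consists of the loops representing `α`, with the subspace
topology. -/
abbrev LoopComponent {m : ℕ} (α : FreeHomotopyClass m) : Type :=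
  {γ : SmoothLoop m // freeClass γ.toMap = α}

/-! ### The pairing of the symplectic form with the fundamental group of the loop space -/

/-- Smooth maps `S¹ × S¹ → (ℝ/ℤ)^m`. -/
structure SmoothToroid (m : ℕ) where
  toFun : UnitAddCircle × UnitAddCircle → Torus m
  smooth : IsSmooth (fun x : ℝ × ℝ => toFun ((x.1 : UnitAddCircle), (x.2 : UnitAddCircle)))

/-- The integral `∫_{S¹ × S¹} u^* ω_std`. -/
noncomputable def SmoothToroid.integral {n : ℕ} (u : SmoothToroid (2 * n)) : ℝ :=
  ∫ s in (0 : ℝ)..1, ∫ t in (0 : ℝ)..1,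
    omegaStd
      (torusDeriv (fun σ : ℝ => u.toFun ((σ : UnitAddCircle), (t : UnitAddCircle))) s)
      (torusDeriv (fun τ : ℝ => u.toFun ((s : UnitAddCircle), (τ : UnitAddCircle))) t)

/-- `u` represents `A ∈ π₁(L_α, z)` if `s ↦ u (s, ·)` is a loop in `L_α` based at `z` whose homotopy
class is `A`. -/
def SmoothToroid.Represents {m : ℕ} {α : FreeHomotopyClass m} {z : LoopComponent α}
    (u : SmoothToroid m) (A : FundamentalGroup (LoopComponent α) z) : Prop :=
  ∃ p : Path z z,
    (∀ (s : unitInterval) (t : UnitAddCircle),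
      (p s).1.toMap t = u.toFun (((s : ℝ) : UnitAddCircle), t)) ∧
    FundamentalGroup.fromPath (Path.Homotopic.Quotient.mk p) = A

open Classical in
/-- The value of the class in `H¹(L (ℝ/ℤ)^(2n); ℝ)` defined by `ω_std` on `A ∈ π₁(L_α, z)`: the
integral of `ω_std` over a smooth map `S¹ × S¹ → (ℝ/ℤ)^(2n)` representing `A`. -/
noncomputable def omegaBar {n : ℕ} {α : FreeHomotopyClass (2 * n)} {z : LoopComponent α}
    (A : FundamentalGroup (LoopComponent α) z) : ℝ :=
  if h : ∃ u : SmoothToroid (2 * n), u.Represents A then h.choose.integral else 0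

/-- The set of the values of `ω_std` on `π₁(L_α, z)`. -/
noncomputable def omegaPeriods {n : ℕ} {α : FreeHomotopyClass (2 * n)} (z : LoopComponent α) :
    Set ℝ :=
  Set.range (fun A : FundamentalGroup (LoopComponent α) z => omegaBar A)

/-! All topology is done in the universal cover `ℝ^m`. A lift of a loop changes by an integer vector
`a` over a period, and `a` classifies the free homotopy classes (`linearClass_bijective`). A toroid
lifts to a map on the plane with integer periods `b` in `s` and `a` in `t`. Since `df ∧ dg = d(f
dg)`, Stokes on the unit square gives the integral `ω_std(b, a)` (`IsToroidLift.integral_eq`).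

Here `a` is fixed by the class of the loops and `b` by the class in `π₁`
(`IsToroidLift.fst_period_unique`), so the pairing is well defined. A straight-line homotopy of
lifts deforms every loop in the loop space to a translation loop `s ↦ z + s b`
(`exists_homotopic_translation`), which gives a smooth toroid, and every integer `b` occurs. Up to
the sign of `b`, the values are therefore `ω_std(a, b)` with `b ∈ ℤ^(2n)` (`omegaPeriods_eq_range`).
Linearity in `a` extracts the factors `h` and `k`, and Bézout coefficients of a primitive `e ≠ 0`
show that `ω_std(e, ·)` is onto `ℤ`.

The `C^∞` topology enters through `JetContinuous`, which expresses continuity of paths and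
homotopies of loops by joint continuity of the `t`-derivatives and carries it over to lifts. -/

/-- The projection `ℝ^m → (ℝ/ℤ)^m`. -/
def torusMk {m : ℕ} (v : Fin m → ℝ) : Torus m := fun j => (v j : UnitAddCircle)

theorem continuous_torusMk {m : ℕ} : Continuous (torusMk : (Fin m → ℝ) → Torus m) :=
  continuous_pi fun j => (AddCircle.continuous_mk' 1).comp (continuous_apply j)

theorem torusMk_eq_iff {m : ℕ} {v w : Fin m → ℝ} :
    torusMk v = torusMk w ↔ ∀ j, ∃ c : ℤ, v j = w j + c := by
  rw [funext_iff]
  refine forall_congr' fun j => ?_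
  change ((v j : ℝ) : UnitAddCircle) = ((w j : ℝ) : UnitAddCircle) ↔ _
  rw [← sub_eq_zero, ← AddCircle.coe_sub, AddCircle.coe_eq_zero_iff]
  refine exists_congr fun c => ?_
  rw [zsmul_eq_mul, mul_one, eq_comm, sub_eq_iff_eq_add']

theorem torusMk_add_int {m : ℕ} (v : Fin m → ℝ) (c : Fin m → ℤ) :
    torusMk (fun j => v j + c j) = torusMk v :=
  torusMk_eq_iff.2 fun j => ⟨c j, rfl⟩

/-! ### Lifts to the universal cover -/

section Lifting

variable {E : Type*} [NormedAddCommGroup E] [NormedSpace ℝ E] {m : ℕ}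

/-- Continuous maps from a normed space to the torus lift to `ℝ^m`. -/
theorem exists_lift {f : E → Torus m} (hf : Continuous f) :
    ∃ F : E → Fin m → ℝ, Continuous F ∧ ∀ x, torusMk (F x) = f x := by
  -- A normed space is simply connected, so each coordinate lifts through the covering `ℝ → ℝ/ℤ`.
  have key : ∀ j, ∃ F : C(E, ℝ), ∀ x, ((F x : ℝ) : UnitAddCircle) = f x j := by
    intro j
    obtain ⟨e₀, he₀⟩ := QuotientAddGroup.mk_surjective (f 0 j)
    obtain ⟨F, ⟨-, hF⟩, -⟩ :=
      (AddCircle.isCoveringMap_coe (1 : ℝ)).existsUnique_continuousMap_lifts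
        ⟨fun x => f x j, (continuous_apply j).comp hf⟩ 0 e₀ he₀
    exact ⟨F, fun x => congrFun hF x⟩
  choose F hF using key
  exact ⟨fun x j => F j x, continuous_pi fun j => (F j).continuous,
    fun x => funext fun j => hF j x⟩

/-- Two lifts of the same map differ by a constant integer vector. -/
theorem lift_unique {F G : E → Fin m → ℝ} (hF : Continuous F) (hG : Continuous G)
    (h : ∀ x, torusMk (F x) = torusMk (G x)) :
    ∃ c : Fin m → ℤ, ∀ x j, F x j = G x j + c j := by
  have h' := fun x j => torusMk_eq_iff.1 (h x) j
  choose c hc using h'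
  refine ⟨c 0, fun x j => ?_⟩
  -- The difference is a continuous integer-valued function on a connected space.
  have hcont : Continuous fun x => c x j := by
    rw [Int.isClosedEmbedding_coe_real.isInducing.continuous_iff]
    have : (Int.cast ∘ fun x => c x j : E → ℝ) = fun x => F x j - G x j := by
      funext y
      simp [hc y j]
    rw [this]
    fun_prop
  rw [hc x j, isPreconnected_univ.constant hcont.continuousOn (Set.mem_univ x) (Set.mem_univ 0)]

end Lifting

/-! ### Winding vectors and the classification of free homotopy classes -/

/-- The loop `γ` has a lift to `ℝ^m` that changes by `a` over a period. -/
def Winds {m : ℕ} (γ : C(UnitAddCircle, Torus m)) (a : Fin m → ℤ) : Prop :=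
  ∃ Γ : ℝ → Fin m → ℝ, Continuous Γ ∧ (∀ t : ℝ, torusMk (Γ t) = γ (t : UnitAddCircle)) ∧
    ∀ t j, Γ (t + 1) j = Γ t j + a j

/-- The linear loop `t ↦ t a`. -/
def linearLoop {m : ℕ} (a : Fin m → ℤ) : C(UnitAddCircle, Torus m) :=
  ⟨fun t j => a j • t, by fun_prop⟩

theorem linearLoop_coe {m : ℕ} (a : Fin m → ℤ) (t : ℝ) :
    torusMk (fun j => a j * t) = linearLoop a (t : UnitAddCircle) := by
  funext j
  change ((a j * t : ℝ) : UnitAddCircle) = a j • (t : UnitAddCircle)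
  rw [← AddCircle.coe_zsmul, zsmul_eq_mul]

theorem winds_linearLoop {m : ℕ} (a : Fin m → ℤ) : Winds (linearLoop a) a :=
  ⟨fun t j => a j * t, by fun_prop, linearLoop_coe a, fun t j => by ring⟩

theorem exists_winds {m : ℕ} (γ : C(UnitAddCircle, Torus m)) : ∃ a, Winds γ a := by
  obtain ⟨Γ, hΓ, h⟩ := exists_lift (f := fun t : ℝ => γ (t : UnitAddCircle))
    (γ.continuous.comp (AddCircle.continuous_mk' 1))
  obtain ⟨a, ha⟩ := lift_unique (F := fun t => Γ (t + 1)) (G := Γ) (by fun_prop) hΓ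
    (fun t => by rw [h, h, AddCircle.coe_add_period])
  exact ⟨a, Γ, hΓ, h, ha⟩

/-- Subtracting `t a` from the lift leaves a periodic function, that is, a map from the circle to
the vector space `ℝ^m`. Scaling it to zero is the homotopy. -/
theorem Winds.freeClass_eq {m : ℕ} {γ : C(UnitAddCircle, Torus m)} {a : Fin m → ℤ}
    (h : Winds γ a) : freeClass γ = linearClass a := by
  obtain ⟨Γ, hΓ, hγ, hper⟩ := h
  have hV : Function.Periodic (fun t j => Γ t j - a j * t) (1 : ℝ) := fun t => by
    funext j
    simp only [hper]
    ring
  have hVc : Continuous hV.lift := by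
    rw [(QuotientAddGroup.isQuotientMap_mk (N := AddSubgroup.zmultiples (1 : ℝ))).continuous_iff]
    change Continuous (fun t j => Γ t j - a j * t)
    fun_prop
  have hsum : ∀ x, γ x = linearLoop a x + torusMk (hV.lift x) := by
    intro x
    obtain ⟨t, rfl⟩ := QuotientAddGroup.mk_surjective x
    refine (hγ t).symm.trans ?_
    refine Eq.trans ?_ (congrArg (· + _) (linearLoop_coe a t))
    funext j
    change ((Γ t j : ℝ) : UnitAddCircle) =
      ((a j * t : ℝ) : UnitAddCircle) + ((Γ t j - a j * t : ℝ) : UnitAddCircle)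
    rw [← AddCircle.coe_add]
    congr 1
    ring
  refine Quotient.sound (s := freeHomotopySetoid m) (ContinuousMap.Homotopic.symm ⟨⟨⟨fun x =>
    linearLoop a x.2 + torusMk ((x.1 : ℝ) • hV.lift x.2), ?_⟩, ?_, ?_⟩⟩)
  · refine ((linearLoop a).continuous.comp continuous_snd).add (continuous_torusMk.comp ?_)
    exact (continuous_subtype_val.comp continuous_fst).smul (hVc.comp continuous_snd)
  · intro x
    funext j
    simp [torusMk, linearLoop]
  · intro x
    simp [hsum]

/-- The lift of a homotopy has one integer `t`-period on the whole plane, which can be read off at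
either end. -/
theorem Winds.unique {m : ℕ} {γ γ' : C(UnitAddCircle, Torus m)} {a a' : Fin m → ℤ}
    (h : Winds γ a) (h' : Winds γ' a') (hh : ContinuousMap.Homotopic γ γ') : a = a' := by
  obtain ⟨Γ, hΓ, hγ, hper⟩ := h
  obtain ⟨Γ', hΓ', hγ', hper'⟩ := h'
  obtain ⟨H⟩ := hh
  -- Clamping with `Set.projIcc` extends the homotopy to a whole plane, where `exists_lift` applies.
  obtain ⟨Φ, hΦ, hΦH⟩ := exists_lift
    (f := fun x : ℝ × ℝ => H (Set.projIcc 0 1 zero_le_one x.1, (x.2 : UnitAddCircle)))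
    (H.continuous.comp ((continuous_projIcc.comp continuous_fst).prodMk
      ((AddCircle.continuous_mk' 1).comp continuous_snd)))
  obtain ⟨b, hb⟩ := lift_unique (F := fun x : ℝ × ℝ => Φ (x.1, x.2 + 1)) (G := Φ)
    (by fun_prop) hΦ (fun x => by rw [hΦH, hΦH]; simp only [AddCircle.coe_add_period])
  obtain ⟨c, hc⟩ := lift_unique (F := fun t : ℝ => Φ (0, t)) (G := Γ) (by fun_prop) hΓ
    (fun t => by rw [hΦH, hγ]; simp)
  obtain ⟨c', hc'⟩ := lift_unique (F := fun t : ℝ => Φ (1, t)) (G := Γ') (by fun_prop) hΓ'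
    (fun t => by rw [hΦH, hγ']; simp)
  funext j
  have h1 := hb (0, 0) j
  have h2 := hb (1, 0) j
  have h3 := hper 0 j
  have h4 := hper' 0 j
  simp only [hc, hc', h3, h4] at h1 h2
  have : (a j : ℝ) = a' j := by linarith
  exact_mod_cast this

theorem linearClass_bijective (m : ℕ) :
    Function.Bijective (linearClass : (Fin m → ℤ) → FreeHomotopyClass m) := by
  constructor
  · intro a b hab
    exact (winds_linearLoop a).unique (winds_linearLoop b)
      (Quotient.exact (s := freeHomotopySetoid m) hab)
  · intro α
    obtain ⟨γ, rfl⟩ := Quotient.exists_rep (s := freeHomotopySetoid m) α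
    obtain ⟨a, ha⟩ := exists_winds γ
    exact ⟨a, ha.freeClass_eq.symm⟩

theorem winds_iff_freeClass_eq {m : ℕ} {γ : C(UnitAddCircle, Torus m)} {a : Fin m → ℤ} :
    Winds γ a ↔ freeClass γ = linearClass a := by
  refine ⟨Winds.freeClass_eq, fun h => ?_⟩
  obtain ⟨b, hb⟩ := exists_winds γ
  rwa [(linearClass_bijective m).1 (h.symm.trans hb.freeClass_eq)]

theorem iterateClass_linearClass {m : ℕ} (a : Fin m → ℤ) (k : ℕ) :
    iterateClass (linearClass a) k = linearClass (k • a) := by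
  refine congrArg freeClass (ContinuousMap.ext fun t => funext fun j => ?_)
  change a j • k • t = (k • a j) • t
  rw [smul_comm, smul_assoc]

theorem trivialClass_eq (m : ℕ) : trivialClass m = linearClass 0 := by
  refine congrArg freeClass (ContinuousMap.ext fun t => funext fun j => ?_)
  change (0 : UnitAddCircle) = (0 : ℤ) • t
  rw [zero_smul]

/-! ### Families of curves with jointly continuous derivatives -/

section JetContinuous

variable {X Y : Type*} [TopologicalSpace X] [TopologicalSpace Y]

/-- The family `f x : ℝ → ℂ` is `k` times differentiable, with derivatives up to order `k` that
are continuous in both variables. -/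
def JetContinuous : ℕ → (X → ℝ → ℂ) → Prop
  | 0, f => Continuous fun x : X × ℝ => f x.1 x.2
  | k + 1, f => (Continuous fun x : X × ℝ => f x.1 x.2) ∧ (∀ x, Differentiable ℝ (f x)) ∧
      JetContinuous k fun x => deriv (f x)

namespace JetContinuous

variable {f g : X → ℝ → ℂ} {k : ℕ}

theorem continuous (hf : JetContinuous k f) : Continuous fun x : X × ℝ => f x.1 x.2 := by
  cases k with
  | zero => exact hf
  | succ k => exact hf.1

/-- The product and chain rules pair the derivative of one factor with the other factor
undifferentiated, whose order must then be lowered. -/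
theorem of_succ (hf : JetContinuous (k + 1) f) : JetContinuous k f := by
  induction k generalizing f with
  | zero => exact hf.1
  | succ k ih => exact ⟨hf.1, hf.2.1, ih hf.2.2⟩

theorem add (hf : JetContinuous k f) (hg : JetContinuous k g) :
    JetContinuous k fun x t => f x t + g x t := by
  induction k generalizing f g with
  | zero => exact Continuous.add hf hg
  | succ k ih =>
    refine ⟨hf.1.add hg.1, fun x => (hf.2.1 x).add (hg.2.1 x), ?_⟩
    have : (fun x => deriv fun t => f x t + g x t) = fun x t => deriv (f x) t + deriv (g x) t :=
      funext fun x => funext fun t => deriv_fun_add (hf.2.1 x t) (hg.2.1 x t)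
    rw [this]
    exact ih hf.2.2 hg.2.2

theorem mul (hf : JetContinuous k f) (hg : JetContinuous k g) :
    JetContinuous k fun x t => f x t * g x t := by
  induction k generalizing f g with
  | zero => exact Continuous.mul hf hg
  | succ k ih =>
    refine ⟨hf.1.mul hg.1, fun x => (hf.2.1 x).mul (hg.2.1 x), ?_⟩
    have : (fun x => deriv fun t => f x t * g x t) =
        fun x t => deriv (f x) t * g x t + f x t * deriv (g x) t :=
      funext fun x => funext fun t => deriv_fun_mul (hf.2.1 x t) (hg.2.1 x t)
    rw [this]
    exact (ih hf.2.2 hg.of_succ).add (ih hf.of_succ hg.2.2)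

theorem const {c : X → ℂ} (hc : Continuous c) : JetContinuous k fun x _ => c x := by
  induction k generalizing c with
  | zero => exact hc.comp continuous_fst
  | succ k ih =>
    refine ⟨hc.comp continuous_fst, fun x => differentiable_const _, ?_⟩
    simpa using ih (c := fun _ => 0) continuous_const

theorem cexp (hf : JetContinuous k f) : JetContinuous k fun x t => Complex.exp (f x t) := by
  induction k with
  | zero => exact Complex.continuous_exp.comp hf
  | succ k ih =>
    refine ⟨Complex.continuous_exp.comp hf.1, fun x => (hf.2.1 x).cexp, ?_⟩
    have : (fun x => deriv fun t => Complex.exp (f x t)) =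
        fun x t => Complex.exp (f x t) * deriv (f x) t :=
      funext fun x => funext fun t => deriv_cexp (hf.2.1 x t)
    rw [this]
    exact (ih hf.of_succ).mul hf.2.2

theorem comp (hf : JetContinuous k f) {φ : Y → X} (hφ : Continuous φ) :
    JetContinuous k fun y => f (φ y) := by
  induction k generalizing f with
  | zero => exact Continuous.comp hf (hφ.prodMap continuous_id)
  | succ k ih => exact ⟨hf.1.comp (hφ.prodMap continuous_id), fun y => hf.2.1 (φ y), ih hf.2.2⟩

/-- With `JetContinuous.iteratedDeriv`, this links the recursive notion to the jets that define the
topology on `SmoothLoop`. -/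
theorem of_iteratedDeriv (hf : ∀ x, ContDiff ℝ ∞ (f x))
    (h : ∀ k, Continuous fun x : X × ℝ => iteratedDeriv k (f x.1) x.2) (k : ℕ) :
    JetContinuous k f := by
  induction k generalizing f with
  | zero => exact h 0
  | succ k ih =>
    refine ⟨h 0, fun x => (hf x).differentiable (by simp), ih (fun x => ?_) fun l => ?_⟩
    · exact (contDiff_infty_iff_deriv.1 (hf x)).2
    · simpa only [iteratedDeriv_succ'] using h (l + 1)

theorem iteratedDeriv (hf : JetContinuous k f) :
    Continuous fun x : X × ℝ => _root_.iteratedDeriv k (f x.1) x.2 := by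
  induction k generalizing f with
  | zero => exact hf
  | succ k ih => simpa only [iteratedDeriv_succ'] using ih hf.2.2

theorem contDiff (hf : ∀ k, JetContinuous k f) (x : X) : ContDiff ℝ ∞ (f x) := by
  refine contDiff_infty.2 fun k => ?_
  have hk := hf k
  clear hf
  induction k generalizing f with
  | zero => exact contDiff_zero.2 (hk.continuous.comp (by fun_prop : Continuous fun t => (x, t)))
  | succ k ih =>
    push_cast
    exact contDiff_succ_iff_deriv.2 ⟨hk.2.1 x, by simp, ih hk.2.2⟩

end JetContinuous

end JetContinuous

/-! ### Smooth lifts and the topology of the loop space -/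

theorem circleEmb_add (x y : UnitAddCircle) :
    circleEmb (x + y) = circleEmb x * circleEmb y := by
  simp [circleEmb, AddCircle.toCircle_add]

theorem isInducing_circleEmb : Topology.IsInducing circleEmb := by
  have h : circleEmb = Subtype.val ∘ AddCircle.homeomorphCircle (T := (1 : ℝ)) one_ne_zero := by
    funext x
    exact congrArg Subtype.val (AddCircle.homeomorphCircle_apply one_ne_zero x).symm
  rw [h]
  exact Topology.IsInducing.subtypeVal.comp (Homeomorph.isInducing _)

theorem continuous_torus_of_circleEmb {X : Type*} [TopologicalSpace X] {m : ℕ} {f : X → Torus m}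
    (h : ∀ j, Continuous fun x => circleEmb (f x j)) : Continuous f :=
  continuous_pi fun j => isInducing_circleEmb.continuous_iff.2 (h j)

theorem IsSmooth.continuous {E : Type*} [NormedAddCommGroup E] [NormedSpace ℝ E] {m : ℕ}
    {f : E → Torus m} (h : IsSmooth f) : Continuous f :=
  continuous_torus_of_circleEmb fun j => (h j).continuous

/-- A continuous real function is smooth if it is so modulo `1`. -/
theorem contDiff_of_circleEmb {E : Type*} [NormedAddCommGroup E] [NormedSpace ℝ E] {f : E → ℝ}
    (hf : Continuous f) (h : ContDiff ℝ ∞ fun x => circleEmb (f x : UnitAddCircle)) :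
    ContDiff ℝ ∞ f := by
  rw [contDiff_iff_contDiffAt]
  intro x₀
  have hpi : (0 : ℝ) < 2 * Real.pi := by positivity
  have hmul : ∀ x, circleEmb (f x : UnitAddCircle) * circleEmb ((-f x₀ : ℝ) : UnitAddCircle) =
      Complex.exp ((2 * Real.pi * (f x - f x₀) : ℝ) * Complex.I) := by
    intro x
    rw [← circleEmb_add, ← AddCircle.coe_add, circleEmb_coe, sub_eq_add_neg]
  -- Rotating the value at `x₀` to `1` keeps the principal logarithm away from its branch cut.
  have hlog : ContDiffAt ℝ ∞ (fun x => f x₀ + (2 * Real.pi)⁻¹ * (Complex.log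
      (circleEmb (f x : UnitAddCircle) * circleEmb ((-f x₀ : ℝ) : UnitAddCircle))).im) x₀ := by
    refine contDiffAt_const.add (contDiffAt_const.mul ?_)
    refine Complex.imCLM.contDiff.contDiffAt.comp x₀ (ContDiffAt.comp x₀ (g := Complex.log) ?_
      (h.contDiffAt.mul contDiffAt_const))
    refine (Complex.contDiffAt_log ?_).restrict_scalars ℝ
    rw [hmul]
    simp
  refine hlog.congr_of_eventuallyEq ?_
  -- The bound `1 / 2` puts the angle `2π (f x - f x₀)` in `(-π, π)`, where `log` inverts `exp`.
  have hev : ∀ᶠ x in nhds x₀, |f x - f x₀| < 1 / 2 :=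
    (hf.tendsto x₀).eventually (Metric.ball_mem_nhds (f x₀) (by norm_num : (0 : ℝ) < 1 / 2))
  filter_upwards [hev] with x hx
  rw [abs_lt] at hx
  rw [hmul, Complex.log_exp]
  · rw [Complex.im_ofReal_mul, Complex.I_im]
    field_simp
    ring
  · rw [Complex.im_ofReal_mul, Complex.I_im]
    nlinarith [Real.pi_pos]
  · rw [Complex.im_ofReal_mul, Complex.I_im]
    nlinarith [Real.pi_pos]

theorem SmoothLoop.ext {m : ℕ} {γ γ' : SmoothLoop m}
    (h : ∀ t : ℝ, γ.toMap (t : UnitAddCircle) = γ'.toMap (t : UnitAddCircle)) : γ = γ' := by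
  cases γ
  cases γ'
  congr
  refine ContinuousMap.ext fun x => ?_
  obtain ⟨t, rfl⟩ := QuotientAddGroup.mk_surjective x
  exact h t

theorem continuous_jet {m : ℕ} (k : ℕ) (j : Fin m) : Continuous (SmoothLoop.jet k j) :=
  continuous_iff_le_induced.2 ((iInf_le _ k).trans (iInf_le _ j))

/-- A map into the loop space is continuous if the coordinates of the loops, as curves in `ℂ`, have
jointly continuous derivatives. -/
theorem continuous_smoothLoop {X : Type*} [TopologicalSpace X] {m : ℕ} {γ : X → SmoothLoop m}
    (h : ∀ j k, JetContinuous k fun x (t : ℝ) =>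
      circleEmb ((γ x).toMap (t : UnitAddCircle) j)) : Continuous γ := by
  refine continuous_iInf_rng.2 fun k => continuous_iInf_rng.2 fun j => continuous_induced_rng.2 ?_
  exact ContinuousMap.continuous_of_continuous_uncurry _ (h j k).iteratedDeriv

/-- A converse of `continuous_smoothLoop`: continuity into `C(ℝ, ℂ)` uncurries because `ℝ` is
locally compact. -/
theorem jetContinuous_of_continuous {X : Type*} [TopologicalSpace X] {m : ℕ} {γ : X → SmoothLoop m}
    (h : Continuous γ) (j : Fin m) (k : ℕ) :
    JetContinuous k fun x (t : ℝ) => circleEmb ((γ x).toMap (t : UnitAddCircle) j) :=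
  JetContinuous.of_iteratedDeriv (fun x => (γ x).smooth j) (fun k =>
    ContinuousMap.continuous_uncurry_of_continuous
      ⟨fun x => SmoothLoop.jet k j (γ x), (continuous_jet k j).comp h⟩) k

/-- A map into the loop space is jointly continuous with the loop parameter. -/
theorem continuous_eval_smoothLoop {X : Type*} [TopologicalSpace X] {m : ℕ} {γ : X → SmoothLoop m}
    (h : Continuous γ) :
    Continuous fun x : X × ℝ => (γ x.1).toMap (x.2 : UnitAddCircle) :=
  continuous_torus_of_circleEmb fun j => (jetContinuous_of_continuous h j 0).continuous

/-- Lifts of a continuous family of smooth loops have jointly continuous derivatives. -/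
theorem jetContinuous_lift {X : Type*} [TopologicalSpace X] {m : ℕ} {γ : X → SmoothLoop m}
    (h : Continuous γ) {F : X → ℝ → Fin m → ℝ} (hF : Continuous fun x : X × ℝ => F x.1 x.2)
    (hγ : ∀ x (t : ℝ), torusMk (F x t) = (γ x).toMap (t : UnitAddCircle)) (j : Fin m) (k : ℕ) :
    JetContinuous k fun x t => (F x t j : ℂ) := by
  have hFj : Continuous fun x : X × ℝ => F x.1 x.2 j := (continuous_apply j).comp hF
  have hg : ∀ k, JetContinuous k fun x (t : ℝ) => circleEmb (F x t j : UnitAddCircle) := by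
    intro k
    have := jetContinuous_of_continuous h j k
    simp only [← hγ] at this
    exact this
  have hsm : ∀ x, ContDiff ℝ ∞ fun t => F x t j := fun x =>
    contDiff_of_circleEmb (hFj.comp (by fun_prop : Continuous fun t : ℝ => (x, t)))
      (JetContinuous.contDiff hg x)
  have hd : ∀ x t, HasDerivAt (fun t => F x t j) (deriv (fun t => F x t j) t) t := fun x t =>
    ((hsm x).differentiable (by simp) t).hasDerivAt
  have hpi : (2 * Real.pi * Complex.I : ℂ) ≠ 0 := by
    simp [Real.pi_ne_zero]
  induction k with
  | zero => exact Complex.continuous_ofReal.comp hFj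
  | succ k ih =>
    refine ⟨Complex.continuous_ofReal.comp hFj,
      fun x t => (hd x t).ofReal_comp.differentiableAt, ?_⟩
    -- For `g = exp (2πi F)` one has `F' = g' exp (-2πi F) / 2πi`. The right side needs only `k`
    -- jets of `F`, so the induction closes.
    have : (fun x => deriv fun t => (F x t j : ℂ)) = fun x t =>
        (deriv (fun t : ℝ => circleEmb (F x t j : UnitAddCircle)) t *
          Complex.exp (-(2 * Real.pi * Complex.I) * F x t j)) *
          (2 * Real.pi * Complex.I)⁻¹ := by
      funext x t
      have h1 : HasDerivAt (fun t => circleEmb (F x t j : UnitAddCircle))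
          (Complex.exp ((2 * Real.pi * Complex.I) * F x t j) *
            ((2 * Real.pi * Complex.I) * (deriv (fun t => F x t j) t : ℝ))) t := by
        have : (fun t => circleEmb (F x t j : UnitAddCircle)) =
            fun t => Complex.exp ((2 * Real.pi * Complex.I) * F x t j) := by
          funext t
          rw [circleEmb_coe]
          push_cast
          ring_nf
        rw [this]
        exact ((hd x t).ofReal_comp.const_mul _).cexp
      rw [h1.deriv, (hd x t).ofReal_comp.deriv, mul_right_comm (Complex.exp _), ← Complex.exp_add,
        neg_mul, add_neg_cancel, Complex.exp_zero, one_mul, mul_comm, inv_mul_cancel_left₀ hpi]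
    rw [this]
    exact ((hg (k + 1)).2.2.mul ((JetContinuous.const continuous_const).mul ih).cexp).mul
      (JetContinuous.const continuous_const)

/-! ### Loops and families of loops built from lifts -/

/-- The smooth loop with a given lift. -/
def smoothLoopOfLift {m : ℕ} (F : ℝ → Fin m → ℝ) (a : Fin m → ℤ)
    (hF : ∀ j, ContDiff ℝ ∞ fun t => F t j) (ha : ∀ t j, F (t + 1) j = F t j + a j) :
    SmoothLoop m :=
  have hp : Function.Periodic (fun t => torusMk (F t)) (1 : ℝ) := fun t => by
    exact (congrArg torusMk (funext (ha t))).trans (torusMk_add_int (F t) a)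
  { toMap := ⟨hp.lift, by
      rw [(QuotientAddGroup.isQuotientMap_mk
        (N := AddSubgroup.zmultiples (1 : ℝ))).continuous_iff]
      exact continuous_torusMk.comp (continuous_pi fun j => (hF j).continuous)⟩
    smooth := fun j => by
      change ContDiff ℝ ∞ fun t => circleEmb (F t j : UnitAddCircle)
      simp only [circleEmb_coe]
      exact ((Complex.ofRealCLM.contDiff.comp (contDiff_const.mul (hF j))).mul contDiff_const).cexp }

theorem smoothLoopOfLift_coe {m : ℕ} (F : ℝ → Fin m → ℝ) (a : Fin m → ℤ)
    (hF : ∀ j, ContDiff ℝ ∞ fun t => F t j) (ha : ∀ t j, F (t + 1) j = F t j + a j) (t : ℝ) :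
    (smoothLoopOfLift F a hF ha).toMap (t : UnitAddCircle) = torusMk (F t) :=
  rfl

theorem freeClass_smoothLoopOfLift {m : ℕ} (F : ℝ → Fin m → ℝ) (a : Fin m → ℤ)
    (hF : ∀ j, ContDiff ℝ ∞ fun t => F t j) (ha : ∀ t j, F (t + 1) j = F t j + a j) :
    freeClass (smoothLoopOfLift F a hF ha).toMap = linearClass a :=
  Winds.freeClass_eq ⟨F, continuous_pi fun j => (hF j).continuous,
    fun t => (smoothLoopOfLift_coe F a hF ha t).symm, ha⟩

theorem nonempty_loopComponent {m : ℕ} (α : FreeHomotopyClass m) : Nonempty (LoopComponent α) := by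
  obtain ⟨a, rfl⟩ := (linearClass_bijective m).2 α
  exact ⟨⟨smoothLoopOfLift (fun t j => a j * t) a (fun j => contDiff_const.mul contDiff_id)
    (fun t j => by ring), freeClass_smoothLoopOfLift _ _ _ _⟩⟩

/-- A family of loops with given lifts, as a continuous map to the loop space. -/
theorem exists_continuous_loopComponent {X : Type*} [TopologicalSpace X] {m : ℕ} {a : Fin m → ℤ}
    {F : X → ℝ → Fin m → ℝ} (hF : ∀ j k, JetContinuous k fun x t => (F x t j : ℂ))
    (ha : ∀ x t j, F x (t + 1) j = F x t j + a j) :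
    ∃ γ : C(X, LoopComponent (linearClass a)),
      ∀ x (t : ℝ), (γ x).1.toMap (t : UnitAddCircle) = torusMk (F x t) := by
  have hsm : ∀ x j, ContDiff ℝ ∞ fun t => F x t j := fun x j => by
    have := Complex.reCLM.contDiff.comp (JetContinuous.contDiff (hF j) x)
    exact this
  refine ⟨⟨fun x => ⟨smoothLoopOfLift (F x) a (hsm x) (ha x), freeClass_smoothLoopOfLift _ _ _ _⟩,
    (continuous_smoothLoop fun j k => ?_).subtype_mk _⟩, fun x t => rfl⟩
  have : (fun x (t : ℝ) => circleEmb ((smoothLoopOfLift (F x) a (hsm x) (ha x)).toMap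
      (t : UnitAddCircle) j)) =
      fun x t => Complex.exp (2 * Real.pi * Complex.I * (F x t j : ℂ)) := by
    funext x t
    rw [smoothLoopOfLift_coe, torusMk, circleEmb_coe]
    push_cast
    ring_nf
  rw [this]
  exact ((JetContinuous.const continuous_const).mul (hF j k)).cexp

/-! ### Loops in the loop space -/

theorem torusMk_add {m : ℕ} (v w : Fin m → ℝ) : torusMk (v + w) = torusMk v + torusMk w :=
  funext fun j => AddCircle.coe_add (p := 1) (v j) (w j)

/-- The toroid `(s, t) ↦ γ t + s b`. -/
def translationToroid {m : ℕ} (γ : SmoothLoop m) (b : Fin m → ℤ) : SmoothToroid m where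
  toFun x := γ.toMap x.2 + linearLoop b x.1
  smooth j := by
    have h : ∀ s : ℝ, linearLoop b (s : UnitAddCircle) j = ((b j * s : ℝ) : UnitAddCircle) :=
      fun s => (congrFun (linearLoop_coe b s) j).symm
    simp only [Pi.add_apply, circleEmb_add, h, circleEmb_coe]
    refine ((γ.smooth j).comp contDiff_snd).mul (ContDiff.cexp ?_)
    exact (Complex.ofRealCLM.contDiff.comp
      (contDiff_const.mul (contDiff_const.mul contDiff_fst))).mul contDiff_const

section Paths

variable {m : ℕ} {a : Fin m → ℤ} {z : LoopComponent (linearClass a)}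

theorem Winds.of_loopComponent (z : LoopComponent (linearClass a)) : Winds z.1.toMap a :=
  winds_iff_freeClass_eq.2 z.2

/-- The loop `s ↦ z + s b` in the loop space. -/
theorem exists_translationPath (z : LoopComponent (linearClass a)) (b : Fin m → ℤ) :
    ∃ q : Path z z, ∀ (s : unitInterval) (t : UnitAddCircle),
      (q s).1.toMap t = (translationToroid z.1 b).toFun (((s : ℝ) : UnitAddCircle), t) := by
  obtain ⟨Z, hZ, hz, hper⟩ := Winds.of_loopComponent z
  have hJ := jetContinuous_lift (X := unitInterval) (γ := fun _ => z.1) continuous_const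
    (F := fun _ => Z) (hZ.comp continuous_snd) (fun _ => hz)
  obtain ⟨γ, hγ⟩ := exists_continuous_loopComponent (X := unitInterval) (a := a)
    (F := fun s t j => Z t j + b j * (s : ℝ)) (fun j k => by
      push_cast
      exact (hJ j k).add (JetContinuous.const (by fun_prop)))
    (fun s t j => by rw [hper]; ring)
  have key : ∀ (s : unitInterval) (t : ℝ), (γ s).1.toMap (t : UnitAddCircle) =
      (translationToroid z.1 b).toFun (((s : ℝ) : UnitAddCircle), (t : UnitAddCircle)) := by
    intro s t
    change _ = z.1.toMap t + linearLoop b (s : ℝ)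
    rw [hγ, ← linearLoop_coe, ← hz, ← torusMk_add]
    rfl
  refine ⟨⟨γ, ?_, ?_⟩, fun s x => ?_⟩
  · refine Subtype.ext (SmoothLoop.ext fun t => ?_)
    exact (hγ 0 t).trans (by simp [← hz])
  · refine Subtype.ext (SmoothLoop.ext fun t => ?_)
    exact (hγ 1 t).trans (by simpa [← hz] using torusMk_add_int (Z t) b)
  · obtain ⟨t, rfl⟩ := QuotientAddGroup.mk_surjective x
    exact key s t

/-- Every loop in the loop space is homotopic to one of the form `s ↦ z + s b`. -/
theorem exists_homotopic_translation (p : Path z z) :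
    ∃ b : Fin m → ℤ, ∀ q : Path z z, (∀ (s : unitInterval) (t : UnitAddCircle),
      (q s).1.toMap t = (translationToroid z.1 b).toFun (((s : ℝ) : UnitAddCircle), t)) →
      p.Homotopic q := by
  have hpc : Continuous fun s => (p s).1 := continuous_subtype_val.comp p.continuous
  have hpe := continuous_eval_smoothLoop hpc
  obtain ⟨P, hP, hPp⟩ := exists_lift
    (f := fun x : ℝ × ℝ => (p (Set.projIcc 0 1 zero_le_one x.1)).1.toMap (x.2 : UnitAddCircle))
    (hpe.comp (((continuous_projIcc (h := zero_le_one)).comp continuous_fst).prodMk continuous_snd))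
  have hPp' : ∀ (s : unitInterval) (t : ℝ), torusMk (P (s, t)) = (p s).1.toMap t := fun s t => by
    rw [hPp]
    simp
  have hP0 : ∀ t : ℝ, torusMk (P (0, t)) = z.1.toMap t := fun t => by
    simpa using hPp' 0 t
  have hP1 : ∀ t : ℝ, torusMk (P (1, t)) = z.1.toMap t := fun t => by
    simpa using hPp' 1 t
  obtain ⟨a', ha'⟩ := lift_unique (F := fun x : ℝ × ℝ => P (x.1, x.2 + 1)) (G := P)
    (by fun_prop) hP (fun x => by rw [hPp, hPp]; simp only [AddCircle.coe_add_period])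
  -- At `s = 0` the map `P` is a lift of `z`, so its `t`-period is the winding vector of `z`.
  obtain rfl : a' = a := Winds.unique (γ := z.1.toMap) (γ' := z.1.toMap)
    ⟨fun t => P (0, t), by fun_prop, hP0, fun t j => ha' (0, t) j⟩
    (Winds.of_loopComponent z) (ContinuousMap.Homotopic.refl _)
  -- Both ends of `P` lift `z`; the vector `b` is their constant displacement.
  obtain ⟨b, hb⟩ := lift_unique (F := fun t : ℝ => P (1, t)) (G := fun t : ℝ => P (0, t))
    (by fun_prop) (by fun_prop) (fun t => by rw [hP0, hP1])
  refine ⟨b, fun q hq => ?_⟩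
  have hJ : ∀ j k, JetContinuous k fun (s : unitInterval) t => (P (s, t) j : ℂ) :=
    jetContinuous_lift hpc (F := fun s t => P (s, t)) (by fun_prop) hPp'
  -- Straight line from `P (s, t)` to `P (0, t) + s b`. Both have the same `t`-period, so each stage
  -- descends to a loop; both agree at `s = 0` and `s = 1`, so endpoints stay fixed.
  obtain ⟨γ, hγ⟩ := exists_continuous_loopComponent (X := unitInterval × unitInterval) (a := a')
    (F := fun x t j => (1 - (x.1 : ℝ)) * P (x.2, t) j +
      (x.1 : ℝ) * (P (0, t) j + b j * (x.2 : ℝ))) (fun j k => by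
      push_cast
      refine ((JetContinuous.const (by fun_prop)).mul ((hJ j k).comp continuous_snd)).add
        ((JetContinuous.const (by fun_prop)).mul (JetContinuous.add ?_
          (JetContinuous.const (by fun_prop))))
      simpa using (hJ j k).comp (continuous_const (y := (0 : unitInterval))))
    (fun x t j => by
      have h1 := ha' (x.2, t) j
      have h2 := ha' (0, t) j
      simp only at h1 h2
      rw [h1, h2]
      ring)
  refine ⟨⟨⟨γ, fun s => ?_, fun s => ?_⟩, fun r s hs => ?_⟩⟩
  · refine Subtype.ext (SmoothLoop.ext fun t => ?_)
    exact (hγ _ t).trans (by simpa using hPp' s t)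
  · refine Subtype.ext (SmoothLoop.ext fun t => (hγ _ t).trans ?_)
    refine Eq.trans ?_ (hq s t).symm
    change _ = z.1.toMap t + linearLoop b (s : ℝ)
    rw [← hP0, ← linearLoop_coe, ← torusMk_add]
    congr 1
    funext j
    simp
  · refine Subtype.ext (SmoothLoop.ext fun t => (hγ _ t).trans ?_)
    rcases hs with rfl | rfl
    · refine Eq.trans ?_ (hPp' 0 t)
      congr 1
      funext j
      simp
      ring
    · refine Eq.trans ?_ (hPp' 1 t)
      congr 1
      funext j
      have h1 := hb t j
      simp [h1]
      ring

theorem translationToroid_represents {b : Fin m → ℤ} {q : Path z z}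
    (hq : ∀ (s : unitInterval) (t : UnitAddCircle),
      (q s).1.toMap t = (translationToroid z.1 b).toFun (((s : ℝ) : UnitAddCircle), t)) :
    (translationToroid z.1 b).Represents
      (FundamentalGroup.fromPath (Path.Homotopic.Quotient.mk q)) :=
  ⟨q, hq, rfl⟩

/-- Every class in `π₁` of the loop space is represented by a smooth toroid. -/
theorem exists_represents (A : FundamentalGroup (LoopComponent (linearClass a)) z) :
    ∃ u : SmoothToroid m, u.Represents A := by
  obtain ⟨p, hp⟩ := Path.Homotopic.Quotient.mk_surjective A.toPath
  -- The path `p` need only be continuous in `s`; its translation representative is smooth in both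
  -- variables.
  obtain ⟨b, hb⟩ := exists_homotopic_translation p
  obtain ⟨q, hq⟩ := exists_translationPath z b
  refine ⟨translationToroid z.1 b, q, hq, ?_⟩
  rw [← Path.Homotopic.Quotient.eq.2 (hb q hq), hp]

/-! ### Periods of lifted toroids -/

/-- `U` is a lift of the toroid `u` with periods `b` in the first and `a` in the second variable. -/
structure IsToroidLift (u : SmoothToroid m) (U : ℝ × ℝ → Fin m → ℝ) (b a : Fin m → ℤ) : Prop where
  continuous : Continuous U
  coe : ∀ x : ℝ × ℝ, torusMk (U x) = u.toFun ((x.1 : UnitAddCircle), (x.2 : UnitAddCircle))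
  add_fst : ∀ s t j, U (s + 1, t) j = U (s, t) j + b j
  add_snd : ∀ s t j, U (s, t + 1) j = U (s, t) j + a j

theorem exists_isToroidLift (u : SmoothToroid m) : ∃ U b a, IsToroidLift u U b a := by
  obtain ⟨U, hU, hUu⟩ := exists_lift u.smooth.continuous
  obtain ⟨b, hb⟩ := lift_unique (F := fun x : ℝ × ℝ => U (x.1 + 1, x.2)) (G := U)
    (by fun_prop) hU (fun x => by rw [hUu, hUu]; simp only [AddCircle.coe_add_period])
  obtain ⟨a, ha⟩ := lift_unique (F := fun x : ℝ × ℝ => U (x.1, x.2 + 1)) (G := U)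
    (by fun_prop) hU (fun x => by rw [hUu, hUu]; simp only [AddCircle.coe_add_period])
  exact ⟨U, b, a, hU, hUu, fun s t => hb (s, t), fun s t => ha (s, t)⟩

theorem IsToroidLift.snd_period {u : SmoothToroid m} {U : ℝ × ℝ → Fin m → ℝ} {b a' : Fin m → ℤ}
    (hU : IsToroidLift u U b a') {A : FundamentalGroup (LoopComponent (linearClass a)) z}
    (hA : u.Represents A) : a' = a := by
  obtain ⟨p, hp, -⟩ := hA
  refine Winds.unique (γ := z.1.toMap) (γ' := z.1.toMap)
    ⟨fun t => U (0, t), hU.continuous.comp (by fun_prop), fun t => ?_, hU.add_snd 0⟩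
    (Winds.of_loopComponent z) (ContinuousMap.Homotopic.refl _)
  rw [hU.coe]
  simpa using (hp 0 t).symm

/-- Evaluating a path homotopy at `t = 0` gives a homotopy of based loops in the torus. In its lift
`Φ` the displacement from `s = 0` to `s = 1` is an integer vector independent of `r`. -/
theorem IsToroidLift.fst_period_unique {u u' : SmoothToroid m} {U U' : ℝ × ℝ → Fin m → ℝ}
    {b a₁ b' a₂ : Fin m → ℤ} (hU : IsToroidLift u U b a₁) (hU' : IsToroidLift u' U' b' a₂)
    {A : FundamentalGroup (LoopComponent (linearClass a)) z}
    (hA : u.Represents A) (hA' : u'.Represents A) : b = b' := by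
  obtain ⟨p, hp, rfl⟩ := hA
  obtain ⟨p', hp', hpp'⟩ := hA'
  obtain ⟨H⟩ : p.Homotopic p' := Path.Homotopic.Quotient.eq.1 hpp'.symm
  have hc : Continuous fun x : unitInterval × unitInterval => (H x).1 :=
    continuous_subtype_val.comp H.continuous
  obtain ⟨Φ, hΦ, hΦH⟩ := exists_lift
    (f := fun x : ℝ × ℝ => (H (Set.projIcc 0 1 zero_le_one x.1,
      Set.projIcc 0 1 zero_le_one x.2)).1.toMap ((0 : ℝ) : UnitAddCircle))
    ((continuous_eval_smoothLoop hc).comp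
      ((((continuous_projIcc (h := zero_le_one)).comp continuous_fst).prodMk
        ((continuous_projIcc (h := zero_le_one)).comp continuous_snd)).prodMk continuous_const))
  obtain ⟨c, hc⟩ := lift_unique (F := fun r : ℝ => Φ (r, 1)) (G := fun r : ℝ => Φ (r, 0))
    (by fun_prop) (by fun_prop) (fun r => by rw [hΦH, hΦH]; simp)
  -- To be used at `r = 0` and `r = 1`. The argument of `V` is clamped because toroid and path are
  -- compared only for `s ∈ [0, 1]`.
  have key : ∀ {v : SmoothToroid m} {V : ℝ × ℝ → Fin m → ℝ} {d e : Fin m → ℤ} {ρ : Path z z}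
      (r : ℝ), IsToroidLift v V d e →
      (∀ (s : unitInterval) (t : UnitAddCircle),
        (ρ s).1.toMap t = v.toFun (((s : ℝ) : UnitAddCircle), t)) →
      (∀ s, H (Set.projIcc 0 1 zero_le_one r, s) = ρ s) → d = c := by
    intro v V d e ρ r hV hρ hr
    obtain ⟨f, hf⟩ := lift_unique
      (F := fun s : ℝ => V ((Set.projIcc 0 1 zero_le_one s : unitInterval), 0))
      (G := fun s : ℝ => Φ (r, s))
      (hV.continuous.comp ((continuous_subtype_val.comp (continuous_projIcc (h := zero_le_one))).prodMk
        continuous_const)) (by fun_prop) (fun s => by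
        rw [hΦH, hV.coe, hr, hρ])
    funext j
    have h0 := hf 0 j
    have h1 := hf 1 j
    have h2 := hV.add_fst 0 0 j
    have h3 := hc r j
    simp at h0 h1 h2 h3
    have : (d j : ℝ) = c j := by linarith
    exact_mod_cast this
  exact (key 0 hU hp (fun s => by simp)).trans (key 1 hU' hp' (fun s => by simp)).symm

end Paths

/-! ### The integral of the symplectic form over a toroid -/

theorem fderiv_add_of_periodic {E : Type*} [NormedAddCommGroup E] [NormedSpace ℝ E] {f : E → ℝ}
    {v : E} {c : ℝ} (h : ∀ x, f (x + v) = f x + c) (x : E) :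
    fderiv ℝ f (x + v) = fderiv ℝ f x := by
  rw [← fderiv_comp_add_right, funext h, fderiv_add_const]

theorem hasDerivAt_comp_fst {g : ℝ × ℝ → ℝ} (hg : ContDiff ℝ ∞ g) (s t : ℝ) :
    HasDerivAt (fun s => g (s, t)) (fderiv ℝ g (s, t) (1, 0)) s := by
  have h1 : HasDerivAt (fun s : ℝ => (s, t)) ((1 : ℝ), (0 : ℝ)) s :=
    (hasDerivAt_id s).prodMk (hasDerivAt_const s t)
  exact (hg.differentiable (by simp) (s, t)).hasFDerivAt.comp_hasDerivAt s h1

theorem hasDerivAt_comp_snd {g : ℝ × ℝ → ℝ} (hg : ContDiff ℝ ∞ g) (s t : ℝ) :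
    HasDerivAt (fun t => g (s, t)) (fderiv ℝ g (s, t) (0, 1)) t := by
  have h1 : HasDerivAt (fun t : ℝ => (s, t)) ((0 : ℝ), (1 : ℝ)) t :=
    (hasDerivAt_const t s).prodMk (hasDerivAt_id t)
  exact (hg.differentiable (by simp) (s, t)).hasFDerivAt.comp_hasDerivAt t h1

theorem integral_fderiv_fst {g : ℝ × ℝ → ℝ} (hg : ContDiff ℝ ∞ g) (t : ℝ) :
    ∫ s in (0 : ℝ)..1, fderiv ℝ g (s, t) (1, 0) = g (1, t) - g (0, t) := by
  have hc : Continuous (fderiv ℝ g) := hg.continuous_fderiv (by simp)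
  exact intervalIntegral.integral_eq_sub_of_hasDerivAt (f := fun s => g (s, t))
    (fun s _ => hasDerivAt_comp_fst hg s t) (Continuous.intervalIntegrable (by fun_prop) _ _)

theorem integral_fderiv_snd {g : ℝ × ℝ → ℝ} (hg : ContDiff ℝ ∞ g) (s : ℝ) :
    ∫ t in (0 : ℝ)..1, fderiv ℝ g (s, t) (0, 1) = g (s, 1) - g (s, 0) := by
  have hc : Continuous (fderiv ℝ g) := hg.continuous_fderiv (by simp)
  exact intervalIntegral.integral_eq_sub_of_hasDerivAt (f := fun t => g (s, t))
    (fun t _ => hasDerivAt_comp_snd hg s t) (Continuous.intervalIntegrable (by fun_prop) _ _)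

/-- The integral of `df ∧ dg` over a period square. -/
theorem integral_wedge_of_periodic {f g : ℝ × ℝ → ℝ} (hf : ContDiff ℝ ∞ f) (hg : ContDiff ℝ ∞ g)
    {bf af bg ag : ℝ} (hf1 : ∀ s t, f (s + 1, t) = f (s, t) + bf)
    (hf2 : ∀ s t, f (s, t + 1) = f (s, t) + af) (hg1 : ∀ s t, g (s + 1, t) = g (s, t) + bg)
    (hg2 : ∀ s t, g (s, t + 1) = g (s, t) + ag) :
    ∫ s in (0 : ℝ)..1, ∫ t in (0 : ℝ)..1,
      (fderiv ℝ f (s, t) (1, 0) * fderiv ℝ g (s, t) (0, 1) -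
        fderiv ℝ g (s, t) (1, 0) * fderiv ℝ f (s, t) (0, 1)) = bf * ag - bg * af := by
  have hdf : Differentiable ℝ f := hf.differentiable (by simp)
  have hdg : Differentiable ℝ g := hg.differentiable (by simp)
  have hg' : ContDiff ℝ ∞ (fderiv ℝ g) := hg.fderiv_right (by simp)
  have hdg' : Differentiable ℝ (fderiv ℝ g) := hg'.differentiable (by simp)
  have hcf' : Continuous (fderiv ℝ f) := hf.continuous_fderiv (by simp)
  have hcg' : Continuous (fderiv ℝ g) := hg'.continuous
  have hper1 : ∀ t, fderiv ℝ g (1, t) = fderiv ℝ g (0, t) := fun t => by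
    simpa using fderiv_add_of_periodic (f := g) (v := (1, 0)) (c := bg)
      (fun ⟨s, t⟩ => by simpa using hg1 s t) (0, t)
  have hper2 : ∀ s, fderiv ℝ g (s, 1) = fderiv ℝ g (s, 0) := fun s => by
    simpa using fderiv_add_of_periodic (f := g) (v := (0, 1)) (c := ag)
      (fun ⟨s, t⟩ => by simpa using hg2 s t) (s, 0)
  have hd : ∀ (v : ℝ × ℝ) x, HasFDerivAt (fun x => f x * fderiv ℝ g x v)
      (f x • (fderiv ℝ (fderiv ℝ g) x).flip v + fderiv ℝ g x v • fderiv ℝ f x) x := fun v x =>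
    (hdf x).hasFDerivAt.mul (by
      simpa using (hdg' x).hasFDerivAt.clm_apply (hasFDerivAt_const v x))
  have hgC2 : ContDiff ℝ 2 g := contDiff_infty.1 hg 2
  have hsymm : ∀ x v w, fderiv ℝ (fderiv ℝ g) x v w = fderiv ℝ (fderiv ℝ g) x w v := fun x =>
    (hgC2.contDiffAt (x := x)).isSymmSndFDerivAt (by simp)
  -- This is `d(f dg) = df ∧ dg`: the second derivatives of `g` cancel by symmetry.
  have hpt : ∀ x : ℝ × ℝ,
      (f x • (fderiv ℝ (fderiv ℝ g) x).flip (0, 1) + fderiv ℝ g x (0, 1) • fderiv ℝ f x) (1, 0) +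
      (-(f x • (fderiv ℝ (fderiv ℝ g) x).flip (1, 0) + fderiv ℝ g x (1, 0) • fderiv ℝ f x)) (0, 1)
      = fderiv ℝ f x (1, 0) * fderiv ℝ g x (0, 1) -
        fderiv ℝ g x (1, 0) * fderiv ℝ f x (0, 1) := by
    intro x
    simp only [_root_.add_apply, _root_.neg_apply,
      _root_.smul_apply, ContinuousLinearMap.flip_apply, smul_eq_mul,
      hsymm x (1, 0) (0, 1)]
    ring
  have hcf := hdf.continuous
  have hdiv := MeasureTheory.integral2_divergence_prod_of_hasFDerivAt
    (fun x => f x * fderiv ℝ g x (0, 1)) (fun x => -(f x * fderiv ℝ g x (1, 0)))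
    (fun x => f x • (fderiv ℝ (fderiv ℝ g) x).flip (0, 1) + fderiv ℝ g x (0, 1) • fderiv ℝ f x)
    (fun x => -(f x • (fderiv ℝ (fderiv ℝ g) x).flip (1, 0) +
      fderiv ℝ g x (1, 0) • fderiv ℝ f x)) 0 0 1 1
    (Continuous.continuousOn (by fun_prop)) (Continuous.continuousOn (by fun_prop))
    (fun x _ => hd _ x) (fun x _ => (hd _ x).neg) (by
      simp only [hpt]
      refine ContinuousOn.integrableOn_compact (isCompact_uIcc.prod isCompact_uIcc)
        (Continuous.continuousOn (by fun_prop)))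
  simp only [hpt] at hdiv
  rw [hdiv, ← intervalIntegral.integral_sub (Continuous.intervalIntegrable (by fun_prop) _ _)
    (Continuous.intervalIntegrable (by fun_prop) _ _), add_sub_assoc,
    ← intervalIntegral.integral_sub (Continuous.intervalIntegrable (by fun_prop) _ _)
    (Continuous.intervalIntegrable (by fun_prop) _ _)]
  -- As `dg` is periodic, opposite edges contribute only a period of `f` times the integral of `dg`
  -- along an edge.
  have e1 : ∀ s, -(f (s, 1) * fderiv ℝ g (s, 1) (1, 0)) - -(f (s, 0) * fderiv ℝ g (s, 0) (1, 0)) =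
      -af * fderiv ℝ g (s, 0) (1, 0) := fun s => by
    have := hf2 s 0
    rw [zero_add] at this
    rw [hper2, this]
    ring
  have e2 : ∀ t, f (1, t) * fderiv ℝ g (1, t) (0, 1) - f (0, t) * fderiv ℝ g (0, t) (0, 1) =
      bf * fderiv ℝ g (0, t) (0, 1) := fun t => by
    have := hf1 0 t
    rw [zero_add] at this
    rw [hper1, this]
    ring
  simp only [e1, e2, intervalIntegral.integral_const_mul, integral_fderiv_fst hg,
    integral_fderiv_snd hg]
  have h1 := hg1 0 0
  have h2 := hg2 0 0
  rw [zero_add] at h1 h2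
  rw [h1, h2]
  ring

/-- The integral of `ω_std` over a toroid whose lift has periods `b` and `a` is `ω_std b a`. -/
theorem IsToroidLift.integral_eq {n : ℕ} {u : SmoothToroid (2 * n)}
    {U : ℝ × ℝ → Fin (2 * n) → ℝ} {b a : Fin (2 * n) → ℤ} (hU : IsToroidLift u U b a) :
    u.integral = omegaStd (fun j => (b j : ℝ)) (fun j => (a j : ℝ)) := by
  have hsm : ∀ j, ContDiff ℝ ∞ fun x => U x j := fun j => by
    refine contDiff_of_circleEmb ((continuous_apply j).comp hU.continuous) ?_
    have h := u.smooth j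
    simp only [← hU.coe] at h
    exact h
  have hcd : ∀ j, Continuous (fderiv ℝ fun x => U x j) := fun j =>
    (hsm j).continuous_fderiv (by simp)
  have h1 : ∀ (s t : ℝ) j, torusDeriv
      (fun σ : ℝ => u.toFun ((σ : UnitAddCircle), (t : UnitAddCircle))) s j =
      fderiv ℝ (fun x => U x j) (s, t) (1, 0) := fun s t j => by
    have hd := hasDerivAt_comp_fst (hsm j) s t
    rw [← hd.deriv, ← circleDeriv_coe _ _ hd.differentiableAt]
    exact congrArg (circleDeriv · s) (funext fun σ => congrFun (hU.coe (σ, t)).symm j)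
  have h2 : ∀ (s t : ℝ) j, torusDeriv
      (fun τ : ℝ => u.toFun ((s : UnitAddCircle), (τ : UnitAddCircle))) t j =
      fderiv ℝ (fun x => U x j) (s, t) (0, 1) := fun s t j => by
    have hd := hasDerivAt_comp_snd (hsm j) s t
    rw [← hd.deriv, ← circleDeriv_coe _ _ hd.differentiableAt]
    exact congrArg (circleDeriv · t) (funext fun τ => congrFun (hU.coe (s, τ)).symm j)
  have hc : ∀ i : Fin n, Continuous fun x : ℝ × ℝ =>
      (fderiv ℝ (fun x => U x (pIdx i)) x (1, 0) * fderiv ℝ (fun x => U x (qIdx i)) x (0, 1) -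
        fderiv ℝ (fun x => U x (qIdx i)) x (1, 0) *
          fderiv ℝ (fun x => U x (pIdx i)) x (0, 1)) := fun i => by
    have := hcd (pIdx i)
    have := hcd (qIdx i)
    fun_prop
  simp only [SmoothToroid.integral, omegaStd, h1, h2]
  have hin : ∀ s : ℝ, ∫ t in (0 : ℝ)..1, ∑ i : Fin n,
      (fderiv ℝ (fun x => U x (pIdx i)) (s, t) (1, 0) *
        fderiv ℝ (fun x => U x (qIdx i)) (s, t) (0, 1) -
        fderiv ℝ (fun x => U x (qIdx i)) (s, t) (1, 0) *
        fderiv ℝ (fun x => U x (pIdx i)) (s, t) (0, 1)) = ∑ i : Fin n, ∫ t in (0 : ℝ)..1,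
      (fderiv ℝ (fun x => U x (pIdx i)) (s, t) (1, 0) *
        fderiv ℝ (fun x => U x (qIdx i)) (s, t) (0, 1) -
        fderiv ℝ (fun x => U x (qIdx i)) (s, t) (1, 0) *
        fderiv ℝ (fun x => U x (pIdx i)) (s, t) (0, 1)) := fun s =>
    intervalIntegral.integral_finsetSum fun i _ =>
      ((hc i).comp (by fun_prop : Continuous fun t : ℝ => (s, t))).intervalIntegrable _ _
  simp only [hin]
  rw [intervalIntegral.integral_finsetSum fun i _ => Continuous.intervalIntegrable
    (intervalIntegral.continuous_parametric_intervalIntegral_of_continuous' (hc i) 0 1) _ _]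
  exact Finset.sum_congr rfl fun i _ => integral_wedge_of_periodic (hsm _) (hsm _)
    (fun s t => hU.add_fst s t _) (fun s t => hU.add_snd s t _) (fun s t => hU.add_fst s t _)
    (fun s t => hU.add_snd s t _)

/-! ### The values of the symplectic form on the fundamental group of the loop space -/

/-- The integral depends only on the two periods of a lift, and these agree for `u` and the chosen
representative. -/
theorem SmoothToroid.Represents.integral_eq {n : ℕ} {a : Fin (2 * n) → ℤ}
    {z : LoopComponent (linearClass a)} {A : FundamentalGroup (LoopComponent (linearClass a)) z}
    {u : SmoothToroid (2 * n)} (hu : u.Represents A) : u.integral = omegaBar A := by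
  have hex : ∃ u : SmoothToroid (2 * n), u.Represents A := ⟨u, hu⟩
  rw [omegaBar, dif_pos hex]
  obtain ⟨U, b, a₁, hU⟩ := exists_isToroidLift u
  obtain ⟨U', b', a₂, hU'⟩ := exists_isToroidLift hex.choose
  rw [hU.integral_eq, hU'.integral_eq, hU.fst_period_unique hU' hu hex.choose_spec,
    hU.snd_period hu, hU'.snd_period hex.choose_spec]

/-- The standard symplectic form on `ℤ^(2n)`, as a sum of determinants. -/
def omegaInt {n : ℕ} (e b : Fin (2 * n) → ℤ) : ℤ :=
  ∑ i : Fin n, !![e (pIdx i), b (pIdx i); e (qIdx i), b (qIdx i)].det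

theorem omegaInt_smul_left {n : ℕ} (c : ℤ) (e b : Fin (2 * n) → ℤ) :
    omegaInt (c • e) b = c * omegaInt e b := by
  simp only [omegaInt, Matrix.det_fin_two_of, Pi.smul_apply, smul_eq_mul, Finset.mul_sum]
  exact Finset.sum_congr rfl fun i _ => by ring

theorem omegaInt_smul_right {n : ℕ} (c : ℤ) (e b : Fin (2 * n) → ℤ) :
    omegaInt e (c • b) = c * omegaInt e b := by
  simp only [omegaInt, Matrix.det_fin_two_of, Pi.smul_apply, smul_eq_mul, Finset.mul_sum]
  exact Finset.sum_congr rfl fun i _ => by ring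

/-- The integral yields `ω(b, a)` but the determinants are `ω(a, b)`; the sign is moved into `b`,
which runs over all of `ℤ^(2n)`. -/
theorem omegaStd_intCast {n : ℕ} (b a : Fin (2 * n) → ℤ) :
    omegaStd (fun j => (b j : ℝ)) (fun j => (a j : ℝ)) = ((omegaInt a ((-1 : ℤ) • b) : ℤ) : ℝ) := by
  rw [omegaInt_smul_right]
  simp only [omegaStd, omegaInt, Matrix.det_fin_two_of, Finset.mul_sum]
  push_cast
  exact Finset.sum_congr rfl fun i _ => by ring

theorem omegaPeriods_eq_range {n : ℕ} {a : Fin (2 * n) → ℤ} (z : LoopComponent (linearClass a)) :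
    omegaPeriods z = Set.range fun b => ((omegaInt a b : ℤ) : ℝ) := by
  ext x
  constructor
  · rintro ⟨A, rfl⟩
    obtain ⟨u, hu⟩ := exists_represents A
    obtain ⟨U, b, a', hU⟩ := exists_isToroidLift u
    refine ⟨(-1 : ℤ) • b, ?_⟩
    obtain rfl := hU.snd_period hu
    change _ = omegaBar A
    rw [← hu.integral_eq, hU.integral_eq, omegaStd_intCast]
  · rintro ⟨b, rfl⟩
    obtain ⟨Z, hZ, hz, hper⟩ := Winds.of_loopComponent z
    -- Translating by `-b` cancels the sign in `omegaStd_intCast`.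
    obtain ⟨q, hq⟩ := exists_translationPath z ((-1 : ℤ) • b)
    have hu := translationToroid_represents hq
    have hU : IsToroidLift (translationToroid z.1 ((-1 : ℤ) • b))
        (fun x j => Z x.2 j + (((-1 : ℤ) • b) j : ℤ) * x.1) ((-1 : ℤ) • b) a := by
      refine ⟨by fun_prop, fun x => ?_, fun s t j => by ring, fun s t j => ?_⟩
      · change _ = z.1.toMap x.2 + linearLoop ((-1 : ℤ) • b) x.1
        rw [← hz, ← linearLoop_coe, ← torusMk_add]
        rfl
      · simp only [hper]
        ring
    refine ⟨_, hu.integral_eq.symm.trans ?_⟩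
    rw [hU.integral_eq, omegaStd_intCast, smul_smul]
    simp

/-! ### Primitive vectors -/

/-- For `a ≠ 0`, `h` is the gcd of the coordinates; a factor `k` of `e = a / h` divides their gcd
`1`. -/
theorem exists_isPrimitiveDecomposition {m : ℕ} (α : FreeHomotopyClass m) :
    ∃ (h : ℕ) (e : Fin m → ℤ), IsPrimitiveDecomposition α h e := by
  obtain ⟨a, rfl⟩ := (linearClass_bijective m).2 α
  by_cases ha : a = 0
  · subst ha
    exact ⟨0, 0, by rw [smul_zero], Or.inr ⟨(trivialClass_eq m).symm, rfl, rfl⟩⟩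
  obtain ⟨i, hi⟩ := Function.ne_iff.1 ha
  obtain ⟨e, he, hgcd⟩ := Finset.extract_gcd a ⟨i, Finset.mem_univ i⟩
  have hnn : 0 ≤ Finset.univ.gcd a := by
    rw [← Finset.normalize_gcd]
    exact Int.nonneg_of_normalize_eq_self (normalize_idem _)
  obtain ⟨h, hh⟩ := Int.eq_ofNat_of_zero_le hnn
  have hae : a = h • e := funext fun j => by
    rw [he j (Finset.mem_univ j), hh, Pi.smul_apply, nsmul_eq_mul]
  refine ⟨h, e, by rw [← hae], Or.inl ⟨fun h0 => ha ?_, ?_, fun k hk f hf hef => hf ?_⟩⟩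
  · rw [trivialClass_eq] at h0
    exact (linearClass_bijective m).1 h0
  · refine Nat.pos_of_ne_zero fun h0 => ha ?_
    rw [hae, h0, zero_smul]
  · have hk1 : (k : ℤ) ∣ 1 := hgcd ▸ Finset.dvd_gcd fun j _ => ⟨f j, by
      rw [hef, Pi.smul_apply, nsmul_eq_mul]⟩
    have : k = 1 := by exact_mod_cast Int.eq_one_of_dvd_one (Int.natCast_nonneg k) hk1
    rw [hef, this, one_smul]

/-- Dividing by the gcd gives a vector of gcd `1`, which primitivity forces to be `e`. The zero
vector satisfies `IsPrimitive` and has to be excluded. -/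
theorem IsPrimitive.gcd_eq_one {m : ℕ} {e : Fin m → ℤ} (he : IsPrimitive e) (h0 : e ≠ 0) :
    Finset.univ.gcd e = 1 := by
  obtain ⟨i, hi⟩ := Function.ne_iff.1 h0
  obtain ⟨f, hf, hgcd⟩ := Finset.extract_gcd e ⟨i, Finset.mem_univ i⟩
  have hnn : 0 ≤ Finset.univ.gcd e := by
    rw [← Finset.normalize_gcd]
    exact Int.nonneg_of_normalize_eq_self (normalize_idem _)
  obtain ⟨h, hh⟩ := Int.eq_ofNat_of_zero_le hnn
  have hef : e = h • f := funext fun j => by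
    rw [hf j (Finset.mem_univ j), hh, Pi.smul_apply, nsmul_eq_mul]
  by_cases hfe : f = e
  · rwa [hfe] at hgcd
  · refine absurd hef (he h (Nat.pos_of_ne_zero fun h' => h0 ?_) f hfe)
    rw [hef, h', zero_smul]

theorem sum_pIdx_add_qIdx {n : ℕ} (f : Fin (2 * n) → ℤ) :
    ∑ j, f j = ∑ i : Fin n, (f (pIdx i) + f (qIdx i)) := by
  rw [← (finProdFinEquiv.trans (finCongr (mul_comm n 2))).sum_comp f, Fintype.sum_prod_type]
  refine Finset.sum_congr rfl fun i _ => ?_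
  rw [Fin.sum_univ_two]
  congr 2 <;> exact Fin.ext (by simp [pIdx, qIdx, finProdFinEquiv, add_comm])

/-- A primitive non-zero vector pairs to `1` with some integer vector. -/
theorem IsPrimitive.exists_omegaInt_eq_one {n : ℕ} {e : Fin (2 * n) → ℤ} (he : IsPrimitive e)
    (h0 : e ≠ 0) : ∃ b, omegaInt e b = 1 := by
  obtain ⟨c, hc⟩ := Finset.gcd_eq_sum_mul Finset.univ e
  rw [he.gcd_eq_one h0, sum_pIdx_add_qIdx] at hc
  -- The Bézout vector `c` rotated by a quarter turn in each `(p_i, q_i)` plane, so that the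
  -- determinants become `e_p c_p + e_q c_q`. The subtraction `j - 1` occurs only for odd `j`.
  let b : Fin (2 * n) → ℤ := fun j =>
    if h : (j : ℕ) % 2 = 0 then -c ⟨j + 1, by omega⟩ else c ⟨j - 1, by omega⟩
  have hp : ∀ i : Fin n, b (pIdx i) = -c (qIdx i) := fun i => dif_pos (Nat.mul_mod_right 2 i)
  have hq : ∀ i : Fin n, b (qIdx i) = c (pIdx i) := fun i =>
    dif_neg (show ¬ (2 * (i : ℕ) + 1) % 2 = 0 by omega)
  refine ⟨b, ?_⟩
  rw [hc, omegaInt]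
  refine Finset.sum_congr rfl fun i _ => ?_
  rw [Matrix.det_fin_two_of, hp, hq]
  ring

theorem range_omegaInt_smul {n : ℕ} (k : ℕ) (a : Fin (2 * n) → ℤ) :
    (Set.range fun b => ((omegaInt (k • a) b : ℤ) : ℝ)) =
      (k : ℝ) • Set.range fun b => ((omegaInt a b : ℤ) : ℝ) := by
  rw [← Set.image_smul, ← Set.range_comp]
  refine congrArg Set.range (funext fun b => ?_)
  rw [← natCast_zsmul, omegaInt_smul_left]
  simp

/-- The factor `h` must stay: for `e = 0` the two ranges differ, but `h = 0` collapses both sides to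
`{0}`. -/
theorem smul_range_omegaInt {n : ℕ} {h : ℕ} {e : Fin (2 * n) → ℤ}
    (H : IsPrimitiveDecomposition (linearClass (h • e)) h e) :
    ((h : ℝ) • Set.range fun b => ((omegaInt e b : ℤ) : ℝ)) =
      (h : ℝ) • Set.range (fun c : ℤ => (c : ℝ)) := by
  rcases H.2 with ⟨hα, -, he⟩ | ⟨-, rfl, -⟩
  · have h0 : e ≠ 0 := fun h0 => hα (by rw [trivialClass_eq, h0, smul_zero])
    obtain ⟨b, hb⟩ := he.exists_omegaInt_eq_one h0
    congr 1
    refine Set.Subset.antisymm ?_ ?_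
    · rintro _ ⟨b, rfl⟩
      exact ⟨_, rfl⟩
    · rintro _ ⟨c, rfl⟩
      exact ⟨c • b, by beta_reduce; rw [omegaInt_smul_right, hb, mul_one]⟩
  · rw [Nat.cast_zero, Set.zero_smul_set (Set.range_nonempty _),
      Set.zero_smul_set (Set.range_nonempty _)]

theorem discreteTopology_omegaPeriods {n : ℕ} {α : FreeHomotopyClass (2 * n)}
    (z : LoopComponent α) : DiscreteTopology (omegaPeriods z) := by
  obtain ⟨a, rfl⟩ := (linearClass_bijective _).2 α
  have : DiscreteTopology (Set.range (Int.cast : ℤ → ℝ)) :=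
    Int.isClosedEmbedding_coe_real.isEmbedding.toHomeomorph.symm.isEmbedding.discreteTopology
  refine DiscreteTopology.of_subset this ?_
  rw [omegaPeriods_eq_range]
  rintro _ ⟨b, rfl⟩
  exact ⟨_, rfl⟩

theorem mainTheorem3 (n : ℕ) :
    -- `[S¹, T^(2n)] ≅ ℤ^(2n)`, each class contains a smooth loop and is of the form `h e`
    Function.Bijective (linearClass : (Fin (2 * n) → ℤ) → FreeHomotopyClass (2 * n)) ∧
    (∀ α : FreeHomotopyClass (2 * n), Nonempty (LoopComponent α) ∧
      ∃ (h : ℕ) (e : Fin (2 * n) → ℤ), IsPrimitiveDecomposition α h e) ∧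
    -- the pairing of `ω_std` with `π₁(L_α)` is well defined
    (∀ (α : FreeHomotopyClass (2 * n)) (z : LoopComponent α)
      (A : FundamentalGroup (LoopComponent α) z),
      (∃ u : SmoothToroid (2 * n), u.Represents A) ∧
      ∀ u : SmoothToroid (2 * n), u.Represents A → u.integral = omegaBar A) ∧
    -- the set of values of `ω_std` on `π₁(L_α)`
    (∀ (α : FreeHomotopyClass (2 * n)) (z : LoopComponent α) (h : ℕ) (e : Fin (2 * n) → ℤ),
      IsPrimitiveDecomposition α h e →
      omegaPeriods z =
        (h : ℝ) • {x : ℝ | ∃ b : Fin (2 * n) → ℤ,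
          x = ((∑ i : Fin n,
            !![e (pIdx i), b (pIdx i); e (qIdx i), b (qIdx i)].det : ℤ) : ℝ)} ∧
      omegaPeriods z = (h : ℝ) • Set.range (fun c : ℤ => (c : ℝ))) ∧
    -- the values for iterated classes
    (∀ (α : FreeHomotopyClass (2 * n)) (k : ℕ) (z : LoopComponent α)
      (w : LoopComponent (iterateClass α k)),
      omegaPeriods w = (k : ℝ) • omegaPeriods z) ∧
    -- `ω_std` is `α`-toroidally rational
    (∀ (α : FreeHomotopyClass (2 * n)) (z : LoopComponent α),
      DiscreteTopology (omegaPeriods z)) := by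
  refine ⟨linearClass_bijective _,
    fun α => ⟨nonempty_loopComponent α, exists_isPrimitiveDecomposition α⟩, fun α z A => ?_,
    fun α z h e H => ?_, fun α k z w => ?_, fun α z => discreteTopology_omegaPeriods z⟩
  · obtain ⟨a, rfl⟩ := (linearClass_bijective _).2 α
    exact ⟨exists_represents A, fun u hu => hu.integral_eq⟩
  · obtain rfl := H.1
    have hset : {x : ℝ | ∃ b : Fin (2 * n) → ℤ, x = ((∑ i : Fin n,
        !![e (pIdx i), b (pIdx i); e (qIdx i), b (qIdx i)].det : ℤ) : ℝ)} =
        Set.range fun b => ((omegaInt e b : ℤ) : ℝ) :=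
      Set.ext fun x => exists_congr fun b => eq_comm
    rw [hset, ← smul_range_omegaInt H, omegaPeriods_eq_range, range_omegaInt_smul]
    exact ⟨rfl, rfl⟩
  · obtain ⟨a, rfl⟩ := (linearClass_bijective _).2 α
    -- The type of `w` depends on the class, so the class is generalised before being replaced by
    -- `linearClass (k • a)`.
    have key : ∀ (β : FreeHomotopyClass (2 * n)) (w : LoopComponent β),
        β = linearClass (k • a) → omegaPeriods w = (k : ℝ) • omegaPeriods z := by
      rintro _ w rfl
      rw [omegaPeriods_eq_range, omegaPeriods_eq_range, range_omegaInt_smul]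
    exact key _ w (iterateClass_linearClass a k)
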